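/- Let $b,\theta_0,\theta_*\in\mathbb C$ with $b^2\notin\mathbb Z$ and $2ib\theta_0\notin\mathbb Z$, and put $Q=b+b^{-1}$. Let $t$ range over the universal cover of $\mathbb C\setminus\{0\}$ (so $\arg t\in\mathbb R$ and $t^a=e^{a(\ln|t|+i\arg t)}$). Put $$M_{k,\mu}(t)=e^{-t/2}t^{\frac12+\mu}\,{}_1F_1\!\left(\tfrac12-k+\mu;1+2\mu;t\right),\qquad W_{k,\mu}(t)=e^{-t/2}t^{\frac12+\mu}\,U\!\left(\mu-k+\tfrac12,1+2\mu,t\right),$$ where $$U(a,c,t)=\frac{\Gamma(1-c)}{\Gamma(a+1-c)}\,{}_1F_1(a;c;t)+\frac{\Gamma(c-1)}{\Gamma(a)}\,t^{1-c}\,{}_1F_1(a+1-c;2-c;t),$$ and $1/\Gamma$ denotes the entire function that vanishes at $0,-1,-2,\dots$. Define $$\boldsymbol B(t)=t^{\frac{b^2}{2}}\begin{pmatrix}M_{-ib\theta_*,-ib\theta_0}(t)\\ M_{-ib\theta_*,ib\theta_0}(t)\end{pmatrix},$$ and, for each integer $n\ge 1$, $$\Omega_n=\left\{-\tfrac{3\pi}{2}+\pi(n-1)<\arg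 t<\tfrac{\pi}{2}+\pi(n-1)\right\},$$ $$\boldsymbol D_n(t)=t^{\frac{b^2}{2}}\begin{pmatrix}e^{2\pi b\theta_*\lfloor\frac{n-1}{2}\rfloor}\,W_{-ib\theta_*,-ib\theta_0}\!\left(e^{-2i\pi\lfloor\frac{n-1}{2}\rfloor}t\right)\\ e^{-2\pi b\theta_*(\lfloor\frac n2\rfloor-\frac12)}\,W_{ib\theta_*,-ib\theta_0}\!\left(e^{-2i\pi(\lfloor\frac n2\rfloor-\frac12)}t\right)\end{pmatrix}.$$ Then for every integer $n\ge1$ there is exactly one constant matrix $C_n\in\mathbb C^{2\times2}$ with $\boldsymbol D_n(t)=C_n\boldsymbol B(t)$ for all $t\in\Omega_n$, namely $$C_n=\begin{pmatrix}K^{(n)}_{++}(\theta_*,\theta_0)&K^{(n)}_{++}(\theta_*,-\theta_0)\\K^{(n)}_{-+}(\theta_*,\theta_0)&K^{(n)}_{-+}(\theta_*,-\theta_0)\end{pmatrix},$$ where $$K^{(n)}_{++}(\theta_*,\theta_0)=-e^{2i\pi(\lfloor\frac n2\rfloor-\frac12)(-\frac12+ib(\theta_0-\theta_*))}\csc(\pi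 b^2)\left(e^{(-1)^n ibQ\pi}\cosh(\pi b(\theta_0-\theta_*))+\cosh(\pi b(\theta_0-\theta_*-ib))\right)\frac{\Gamma(2ib\theta_0)}{\Gamma(\frac12+ib(\theta_0+\theta_*))},$$ $$K^{(n)}_{-+}(\theta_*,\theta_0)=e^{-2i\pi(\lfloor\frac n2\rfloor-\frac12)(\frac12-ib(\theta_0+\theta_*))}\frac{\Gamma(2ib\theta_0)}{\Gamma(\frac12+ib(\theta_0-\theta_*))}.$$ -/

import Mathlib

/-!
A point `t` of the universal cover of `ℂ ∖ {0}` is represented by its logarithm `s : ℂ`,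
so that `t = exp s`, `arg t = Im s`, and `t ^ a = exp (a * s)`. Multiplying `t` by `exp (i φ)`
is adding `i φ` to `s`.
-/

namespace ConfluentBPZ

noncomputable section

open Complex

/-- The confluent hypergeometric function of the first kind
`₁F₁(a; c; z) = ∑ₖ (a)ₖ / (c)ₖ * zᵏ / k!`
(for `c` different from `0, -1, -2, …`). -/
def hyp1F1 (a c z : ℂ) : ℂ :=
  ∑' k : ℕ, (ascPochhammer ℂ k).eval a / (ascPochhammer ℂ k).eval c * (z ^ k / (k.factorial : ℂ))

/-- The confluent hypergeometric function of the second kind `U(a, c, t)`, `t = exp s`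
(for `c` not an integer). Since `Complex.Gamma` is `0` at its poles, dividing by it amounts to
multiplying by the entire function `1 / Γ`. -/
def hypU (a c s : ℂ) : ℂ :=
  Gamma (1 - c) / Gamma (a + 1 - c) * hyp1F1 a c (exp s)
    + Gamma (c - 1) / Gamma a * exp ((1 - c) * s) * hyp1F1 (a + 1 - c) (2 - c) (exp s)

/-- The Whittaker function of the first kind `M_{k, μ}(t)`, `t = exp s`. -/
def whittakerM (k μ s : ℂ) : ℂ :=
  exp (-(exp s) / 2) * exp ((1 / 2 + μ) * s) * hyp1F1 (1 / 2 - k + μ) (1 + 2 * μ) (exp s)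

/-- The Whittaker function of the second kind `W_{k, μ}(t)`, `t = exp s`. -/
def whittakerW (k μ s : ℂ) : ℂ :=
  exp (-(exp s) / 2) * exp ((μ + 1 / 2) * s) * hypU (μ - k + 1 / 2) (1 + 2 * μ) s

/-- The Stokes sector `Ω_n : -3π/2 + π (n - 1) < arg t < π/2 + π (n - 1)`. -/
def stokesSector (n : ℤ) : Set ℂ :=
  {s | -(3 * Real.pi / 2) + Real.pi * ((n : ℝ) - 1) < s.im ∧
    s.im < Real.pi / 2 + Real.pi * ((n : ℝ) - 1)}

/-- The degenerate confluent conformal blocks of the first kind `B(t) = (B₊(t), B₋(t))`. -/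
def blockB (b θs θ0 s : ℂ) : Fin 2 → ℂ :=
  ![exp (b ^ 2 / 2 * s) * whittakerM (-(I * b * θs)) (-(I * b * θ0)) s,
    exp (b ^ 2 / 2 * s) * whittakerM (-(I * b * θs)) (I * b * θ0) s]

/-- The degenerate confluent conformal blocks of the second kind `D_n(t)`. The integer divisions
`(n - 1) / 2` and `n / 2` are the floors of the corresponding rational numbers. -/
def blockD (b θs θ0 : ℂ) (n : ℤ) (s : ℂ) : Fin 2 → ℂ :=
  let p : ℂ := (((n - 1) / 2 : ℤ) : ℂ)
  let q : ℂ := ((n / 2 : ℤ) : ℂ) - 1 / 2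
  ![exp (b ^ 2 / 2 * s) * (exp (2 * Real.pi * b * θs * p) *
      whittakerW (-(I * b * θs)) (-(I * b * θ0)) (s - 2 * I * Real.pi * p)),
    exp (b ^ 2 / 2 * s) * (exp (-(2 * Real.pi * b * θs * q)) *
      whittakerW (I * b * θs) (-(I * b * θ0)) (s - 2 * I * Real.pi * q))]

/-- `C` is a connection matrix from `B` to `D_n`: `D_n(t) = C B(t)` for all `t ∈ Ω_n`. -/
def IsConnectionMatrix (b θs θ0 : ℂ) (n : ℤ) (C : Matrix (Fin 2) (Fin 2) ℂ) : Prop :=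
  ∀ s ∈ stokesSector n, blockD b θs θ0 n s = C.mulVec (blockB b θs θ0 s)

/-- `K_{++}^{(n)}(θs, θ0)`, where `Q = b + 1 / b` and `csc x = 1 / sin x`. -/
def Kpp (b : ℂ) (n : ℤ) (θs θ0 : ℂ) : ℂ :=
  let Q : ℂ := b + b⁻¹
  (-exp (2 * I * Real.pi * (((n / 2 : ℤ) : ℂ) - 1 / 2) * (-(1 / 2) + I * b * (θ0 - θs))))
    * (sin (Real.pi * b ^ 2))⁻¹
    * (exp ((-1) ^ n * I * b * Q * Real.pi) * cosh (Real.pi * b * (θ0 - θs))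
        + cosh (Real.pi * b * (θ0 - θs - I * b)))
    * (Gamma (2 * I * b * θ0) / Gamma (1 / 2 + I * b * (θ0 + θs)))

/-- `K_{-+}^{(n)}(θs, θ0)`. -/
def Kmp (b : ℂ) (n : ℤ) (θs θ0 : ℂ) : ℂ :=
  exp (-(2 * I * Real.pi * (((n / 2 : ℤ) : ℂ) - 1 / 2) * (1 / 2 - I * b * (θ0 + θs))))
    * (Gamma (2 * I * b * θ0) / Gamma (1 / 2 + I * b * (θ0 - θs)))

end

end ConfluentBPZ

/-!
The Whittaker function `W_{k, μ}` is by definition a combination of `M_{k, μ}` and `M_{k, -μ}`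
with Gamma quotients as coefficients (`whittakerW_eq`), and `M_{k, μ}` has simple monodromy:
a full turn multiplies it by `exp (2πi (1/2 + μ))`, while a half turn in addition replaces `k` by
`-k` (`whittakerM_sub_half_turn`). The latter is Kummer's transformation
`exp (-z) ₁F₁(a; c; z) = ₁F₁(c - a; c; -z)`, obtained from a Cauchy product and the
Chu–Vandermonde identity. In this way both entries of `D_n` become explicit
combinations of the entries of `B`. For the first row the trigonometric factor in `K_{++}`
collapses to a single exponential because `cosh x` and `cosh (x - iβ)` combine to `exp (± x)`
(`trig_factor_of_odd`, `trig_factor_of_even`).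

The connection matrix is unique because the entries of `B` are linearly independent on every
nonempty open set: a linear relation continues analytically to all `s`, and the shift
`s ↦ s + 2πi` multiplies the two entries by different factors, since `2ibθ₀` is not an integer
(`blockB_linearIndependent`).
-/

namespace ConfluentBPZ

open Complex Finset

/-! ### The confluent hypergeometric series -/

/-- The Chu–Vandermonde identity
`∑ⱼ (n choose j) (-1)ʲ (a)ⱼ (c + j)ₙ₋ⱼ = (c - a)ₙ`. -/
theorem sum_choose_mul_ascPochhammer (n : ℕ) (a c : ℂ) :
    ∑ ij ∈ antidiagonal n, (n.choose ij.1 : ℂ) * ((-1) ^ ij.1 *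
      (ascPochhammer ℂ ij.1).eval a * (ascPochhammer ℂ ij.2).eval (c + ij.1))
      = (ascPochhammer ℂ n).eval (c - a) := by
  induction n generalizing c with
  | zero => simp
  | succ n ih =>
    have hleft : ∀ (x : ℂ) (k : ℕ), (ascPochhammer ℂ (k + 1)).eval x
        = x * (ascPochhammer ℂ k).eval (x + 1) := fun x k => by
      simp [ascPochhammer_succ_left, Polynomial.eval_comp]
    rw [Finset.sum_antidiagonal_choose_succ_mul
      (fun i j => (-1) ^ i * (ascPochhammer ℂ i).eval a * (ascPochhammer ℂ j).eval (c + i)),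
      hleft, show c - a + 1 = (c + 1) - a by ring, ← ih (c + 1), Finset.mul_sum,
      ← Finset.sum_add_distrib]
    refine Finset.sum_congr rfl fun ij hij => ?_
    have hsymm : n.choose ij.2 = n.choose ij.1 :=
      (Nat.choose_symm_of_eq_add (mem_antidiagonal.mp hij).symm).symm
    rw [hsymm, hleft, ascPochhammer_succ_eval, pow_succ, Nat.cast_add, Nat.cast_one,
      show c + (ij.1 : ℂ) + 1 = c + 1 + ij.1 by ring,
      show c + ((ij.1 : ℂ) + 1) = c + 1 + ij.1 by ring]
    ring

/-- The series defining `₁F₁` converges absolutely; when `c` is a pole it is a finite sum because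
of `x / 0 = 0`, so no condition on `c` is needed. -/
theorem summable_norm_hyp1F1_term (a c z : ℂ) :
    Summable fun k : ℕ => ‖(ascPochhammer ℂ k).eval a / (ascPochhammer ℂ k).eval c *
      (z ^ k / (k.factorial : ℂ))‖ := by
  have hinv : Filter.Tendsto (fun k : ℕ => ((k : ℂ))⁻¹) Filter.atTop (nhds 0) :=
    tendsto_inv_atTop_nhds_zero_nat
  have hnum : Filter.Tendsto (fun k : ℕ => (1 + a * (k : ℂ)⁻¹) / (1 + c * (k : ℂ)⁻¹) *
      (z * ((k + 1 : ℕ) : ℂ)⁻¹)) Filter.atTop (nhds ((1 + a * 0) / (1 + c * 0) * (z * 0))) :=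
    ((tendsto_const_nhds.add (hinv.const_mul a)).div
      (tendsto_const_nhds.add (hinv.const_mul c)) (by simp)).mul
      ((hinv.comp (Filter.tendsto_add_atTop_nat 1)).const_mul z)
  have hratio : ∀ᶠ k : ℕ in Filter.atTop, ‖(a + k) / (c + k) * (z / ((k + 1 : ℕ) : ℂ))‖ ≤ 1 / 2 := by
    rw [mul_zero, mul_zero] at hnum
    have hlt := (tendsto_order.1 (tendsto_norm_zero.comp (by simpa using hnum))).2
      (1 / 2 : ℝ) (by norm_num)
    filter_upwards [hlt, Filter.eventually_ne_atTop 0] with k hk hk0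
    have hk0' : (k : ℂ) ≠ 0 := by exact_mod_cast hk0
    refine le_of_eq_of_le ?_ hk.le
    simp only [Function.comp]
    rw [show (1 + a * (k : ℂ)⁻¹) = (a + k) / k by field_simp; ring,
      show (1 + c * (k : ℂ)⁻¹) = (c + k) / k by field_simp; ring,
      div_div_div_cancel_right₀ hk0']
    push_cast
    rw [div_eq_mul_inv z]
  refine summable_of_ratio_norm_eventually_le (r := 1 / 2) (by norm_num) ?_
  filter_upwards [hratio] with k hk
  have hstep : (ascPochhammer ℂ (k + 1)).eval a / (ascPochhammer ℂ (k + 1)).eval c *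
      (z ^ (k + 1) / ((k + 1).factorial : ℂ)) =
      ((a + k) / (c + k) * (z / ((k + 1 : ℕ) : ℂ))) *
      ((ascPochhammer ℂ k).eval a / (ascPochhammer ℂ k).eval c * (z ^ k / (k.factorial : ℂ))) := by
    rw [ascPochhammer_succ_eval, ascPochhammer_succ_eval, Nat.factorial_succ, pow_succ,
      Nat.cast_mul, mul_div_mul_comm, mul_comm ((k + 1 : ℕ) : ℂ), mul_div_mul_comm]
    ring
  rw [norm_norm, norm_norm, hstep, norm_mul]
  exact mul_le_mul_of_nonneg_right hk (norm_nonneg _)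

theorem differentiable_hyp1F1 (a c : ℂ) : Differentiable ℂ (hyp1F1 a c) := by
  intro z
  have hz : z ∈ Metric.ball (0 : ℂ) (‖z‖ + 1) := by simp
  refine DifferentiableOn.differentiableAt (s := Metric.ball 0 (‖z‖ + 1)) ?_
    (Metric.isOpen_ball.mem_nhds hz)
  refine differentiableOn_tsum_of_summable_norm
    (summable_norm_hyp1F1_term a c ((‖z‖ + 1 : ℝ) : ℂ)) (fun k => by fun_prop)
    Metric.isOpen_ball fun k w hw => ?_
  rw [norm_mul, norm_mul, norm_div (w ^ k), norm_div (_ ^ k), norm_pow, norm_pow, norm_real,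
    Real.norm_of_nonneg (by positivity : 0 ≤ ‖z‖ + 1)]
  have hw' : ‖w‖ ≤ ‖z‖ + 1 := (mem_ball_zero_iff.mp hw).le
  gcongr

theorem hyp1F1_zero (a c : ℂ) : hyp1F1 a c 0 = 1 := by
  rw [hyp1F1, tsum_eq_single 0 fun k hk => by simp [hk]]
  simp

theorem ascPochhammer_eval_ne_zero {c : ℂ} (hc : ∀ j : ℕ, c + j ≠ 0) (k : ℕ) :
    (ascPochhammer ℂ k).eval c ≠ 0 := by
  induction k with
  | zero => simp
  | succ k ih => rw [ascPochhammer_succ_eval]; exact mul_ne_zero ih (hc k)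

/-- Splitting of the Pochhammer symbol: `(c)ᵢ₊ⱼ = (c)ᵢ (c + i)ⱼ`. -/
theorem ascPochhammer_eval_add (c : ℂ) (i j : ℕ) :
    (ascPochhammer ℂ (i + j)).eval c
      = (ascPochhammer ℂ i).eval c * (ascPochhammer ℂ j).eval (c + i) := by
  rw [← ascPochhammer_mul]
  simp [Polynomial.eval_comp]

/-- Kummer's transformation. -/
theorem exp_neg_mul_hyp1F1 {c : ℂ} (hc : ∀ j : ℕ, c + j ≠ 0) (a z : ℂ) :
    exp (-z) * hyp1F1 a c z = hyp1F1 (c - a) c (-z) := by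
  have hexp : exp (-z) = ∑' k : ℕ, (-z) ^ k / (k.factorial : ℂ) := by
    rw [Complex.exp_eq_exp_ℂ, NormedSpace.exp_eq_tsum_div]
  rw [mul_comm, hexp, hyp1F1, hyp1F1,
    tsum_mul_tsum_eq_tsum_sum_antidiagonal_of_summable_norm (summable_norm_hyp1F1_term a c z)
      (NormedSpace.norm_expSeries_div_summable (-z))]
  refine tsum_congr fun n => ?_
  rw [← sum_choose_mul_ascPochhammer n a c, Finset.sum_div, Finset.sum_mul]
  refine Finset.sum_congr rfl fun ij hij => ?_
  obtain ⟨i, j⟩ := ij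
  obtain rfl : i + j = n := mem_antidiagonal.mp hij
  have hi := ascPochhammer_eval_ne_zero hc i
  have hij' := ascPochhammer_eval_ne_zero hc (i + j)
  rw [ascPochhammer_eval_add] at hij' ⊢
  have hj := right_ne_zero_of_mul hij'
  have hfac : ((i + j).choose i : ℂ) * i.factorial * j.factorial = (i + j).factorial := by
    rw [Nat.choose_symm_add]
    exact_mod_cast Nat.add_choose_mul_factorial_mul_factorial i j
  have h1 : (i.factorial : ℂ) ≠ 0 := by exact_mod_cast i.factorial_ne_zero
  have h2 : (j.factorial : ℂ) ≠ 0 := by exact_mod_cast j.factorial_ne_zero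
  have h3 : ((i + j).choose i : ℂ) ≠ 0 := by
    exact_mod_cast (Nat.choose_pos (Nat.le_add_right i j)).ne'
  have hsign : ((-1 : ℂ) ^ i) * (-1) ^ i = 1 := by rw [← mul_pow]; simp
  rw [← hfac, neg_pow z j, neg_pow z (i + j), pow_add, pow_add]
  field_simp
  linear_combination (-((ascPochhammer ℂ i).eval a * z ^ i * z ^ j)) * hsign

/-! ### Whittaker functions -/

/-- The connection formula between the Whittaker functions of the second and first kind. -/
theorem whittakerW_eq (k μ s : ℂ) :
    whittakerW k μ s = Gamma (-(2 * μ)) / Gamma (1 / 2 - μ - k) * whittakerM k μ s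
      + Gamma (2 * μ) / Gamma (1 / 2 + μ - k) * whittakerM k (-μ) s := by
  have hexp : exp ((1 / 2 + -μ) * s) = exp ((μ + 1 / 2) * s) * exp ((1 - (1 + 2 * μ)) * s) := by
    rw [← Complex.exp_add]; ring_nf
  rw [whittakerW, whittakerM, whittakerM, hypU, hexp,
    show μ - k + 1 / 2 + 1 - (1 + 2 * μ) = 1 / 2 - μ - k by ring,
    show 1 - (1 + 2 * μ) = -(2 * μ) by ring, show 1 + 2 * μ - 1 = 2 * μ by ring,
    show μ - k + 1 / 2 = 1 / 2 + μ - k by ring, show 2 - (1 + 2 * μ) = 1 + 2 * -μ by ring,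
    show 1 / 2 - k + μ = 1 / 2 + μ - k by ring, show 1 / 2 - k + -μ = 1 / 2 - μ - k by ring,
    show (1 / 2 + μ) * s = (μ + 1 / 2) * s by ring]
  ring

theorem exp_sub_two_pi_int (s : ℂ) (p : ℤ) : exp (s - 2 * I * Real.pi * p) = exp s := by
  rw [show s - 2 * I * Real.pi * p = s - p * (2 * Real.pi * I) by ring]
  exact Complex.exp_periodic.sub_int_mul_eq p

theorem whittakerM_sub_full_turn (k μ s : ℂ) (p : ℤ) :
    whittakerM k μ (s - 2 * I * Real.pi * p)
      = exp (-(2 * I * Real.pi * p * (1 / 2 + μ))) * whittakerM k μ s := by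
  rw [whittakerM, whittakerM, exp_sub_two_pi_int, mul_sub, sub_eq_add_neg, Complex.exp_add,
    show -((1 / 2 + μ) * (2 * I * Real.pi * p)) = -(2 * I * Real.pi * p * (1 / 2 + μ)) by ring]
  ring

/-- An odd number of half turns changes the sign of `t`, and Kummer's transformation then
changes the sign of `k`. -/
theorem whittakerM_sub_half_turn {μ : ℂ} (hμ : ∀ m : ℤ, 2 * μ ≠ m) (k s : ℂ) (p : ℤ) :
    whittakerM k μ (s - 2 * I * Real.pi * (p - 1 / 2))
      = exp (-(2 * I * Real.pi * (p - 1 / 2) * (1 / 2 + μ))) * whittakerM (-k) μ s := by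
  have hexp : exp (s - 2 * I * Real.pi * (p - 1 / 2)) = -exp s := by
    rw [show s - 2 * I * Real.pi * (p - 1 / 2) = (s + Real.pi * I) - 2 * I * Real.pi * p by ring,
      exp_sub_two_pi_int, Complex.exp_add, Complex.exp_pi_mul_I]
    ring
  have hc : ∀ j : ℕ, 1 + 2 * μ + j ≠ 0 := fun j h =>
    hμ (-(j + 1)) (by push_cast; linear_combination h)
  have hkummer := exp_neg_mul_hyp1F1 hc (1 / 2 - -k + μ) (exp s)
  rw [show 1 + 2 * μ - (1 / 2 - -k + μ) = 1 / 2 - k + μ by ring] at hkummer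
  have hhalf : exp (- -exp s / 2) * exp (-exp s) = exp (-exp s / 2) := by
    rw [← Complex.exp_add]; ring_nf
  rw [whittakerM, whittakerM, hexp, ← hkummer, ← hhalf, mul_sub, sub_eq_add_neg, Complex.exp_add,
    show -((1 / 2 + μ) * (2 * I * Real.pi * (p - 1 / 2)))
      = -(2 * I * Real.pi * (p - 1 / 2) * (1 / 2 + μ)) by ring]
  ring

/-! ### The connection coefficients -/

theorem trig_factor_of_odd {β : ℂ} (hβ : sin β ≠ 0) (x : ℂ) :
    (sin β)⁻¹ * (-exp (-(β * I)) * cosh x + cosh (x - β * I)) = I * exp (-x) := by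
  rw [Complex.cosh_sub, Complex.cosh_mul_I, Complex.sinh_mul_I, ← neg_mul, Complex.exp_mul_I,
    Complex.cos_neg, Complex.sin_neg, ← Complex.cosh_sub_sinh]
  field_simp
  ring

theorem trig_factor_of_even {β : ℂ} (hβ : sin β ≠ 0) (x : ℂ) :
    (sin β)⁻¹ * (-exp (β * I) * cosh x + cosh (x - β * I)) = -(I * exp x) := by
  rw [Complex.cosh_sub, Complex.cosh_mul_I, Complex.sinh_mul_I, Complex.exp_mul_I,
    ← Complex.cosh_add_sinh]
  field_simp
  ring

theorem sin_pi_mul_ne_zero {x : ℂ} (hx : ∀ m : ℤ, x ≠ m) : sin (Real.pi * x) ≠ 0 := by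
  rw [Ne, Complex.sin_eq_zero_iff]
  rintro ⟨m, hm⟩
  have hpi : (Real.pi : ℂ) ≠ 0 := by exact_mod_cast Real.pi_ne_zero
  exact hx m (mul_left_cancel₀ hpi (hm.trans (mul_comm _ _)))

/-- The coefficient `K_{++}` in closed exponential form, with `⌊(n - 1) / 2⌋` full turns. -/
theorem Kpp_eq {b : ℂ} (hb : ∀ m : ℤ, b ^ 2 ≠ (m : ℂ)) (n : ℤ) (θs θ0 : ℂ) :
    Kpp b n θs θ0 = exp (2 * I * Real.pi * ((n - 1) / 2 : ℤ) * (-(1 / 2) + I * b * (θ0 - θs)))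
      * (Gamma (2 * I * b * θ0) / Gamma (1 / 2 + I * b * (θ0 + θs))) := by
  have hb0 : b ≠ 0 := fun h => hb 0 (by simp [h])
  have hsin := sin_pi_mul_ne_zero hb
  have hbQ : b * (b + b⁻¹) = b ^ 2 + 1 := by field_simp
  have hexp_half_pi : exp (Real.pi * I / 2) = I := by
    rw [show (Real.pi : ℂ) * I / 2 = Real.pi / 2 * I by ring, Complex.exp_pi_div_two_mul_I]
  have hcosh : cosh (Real.pi * b * (θ0 - θs - I * b))
      = cosh (Real.pi * b * (θ0 - θs) - Real.pi * b ^ 2 * I) := by ring_nf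
  unfold Kpp
  simp only
  congr 1
  rw [hcosh]
  rcases Int.even_or_odd n with hn | hn
  · have hp : (((n - 1) / 2 : ℤ) : ℂ) = ((n / 2 : ℤ) : ℂ) - 1 / 2 - 1 / 2 := by
      rw [show (n - 1) / 2 = n / 2 - 1 by obtain ⟨j, rfl⟩ := hn; omega]
      push_cast; ring
    have hQ : exp ((-1) ^ n * I * b * (b + b⁻¹) * Real.pi) = -exp (Real.pi * b ^ 2 * I) := by
      rw [hn.neg_one_zpow, show 1 * I * b * (b + b⁻¹) * Real.pi
        = Real.pi * b ^ 2 * I + Real.pi * I by linear_combination I * Real.pi * hbQ,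
        Complex.exp_add, Complex.exp_pi_mul_I]
      ring
    rw [hQ, mul_assoc, trig_factor_of_even hsin, hp,
      show 2 * I * Real.pi * (((n / 2 : ℤ) : ℂ) - 1 / 2 - 1 / 2) * (-(1 / 2) + I * b * (θ0 - θs))
        = 2 * I * Real.pi * (((n / 2 : ℤ) : ℂ) - 1 / 2) * (-(1 / 2) + I * b * (θ0 - θs))
          + Real.pi * b * (θ0 - θs) + Real.pi * I / 2 by
        linear_combination (-(Real.pi * b * (θ0 - θs))) * I_mul_I,
      Complex.exp_add, Complex.exp_add, hexp_half_pi]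
    ring
  · have hp : (((n - 1) / 2 : ℤ) : ℂ) = ((n / 2 : ℤ) : ℂ) - 1 / 2 + 1 / 2 := by
      rw [show (n - 1) / 2 = n / 2 by obtain ⟨j, rfl⟩ := hn; omega]
      ring
    have hQ : exp ((-1) ^ n * I * b * (b + b⁻¹) * Real.pi) = -exp (-(Real.pi * b ^ 2 * I)) := by
      rw [hn.neg_one_zpow, show -1 * I * b * (b + b⁻¹) * Real.pi
        = -(Real.pi * b ^ 2 * I) + -(Real.pi * I) by linear_combination (-(I * Real.pi)) * hbQ,
        Complex.exp_add, Complex.exp_neg (Real.pi * I), Complex.exp_pi_mul_I]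
      norm_num
    rw [hQ, mul_assoc, trig_factor_of_odd hsin, hp,
      show 2 * I * Real.pi * (((n / 2 : ℤ) : ℂ) - 1 / 2 + 1 / 2) * (-(1 / 2) + I * b * (θ0 - θs))
        = 2 * I * Real.pi * (((n / 2 : ℤ) : ℂ) - 1 / 2) * (-(1 / 2) + I * b * (θ0 - θs))
          + -(Real.pi * b * (θ0 - θs)) + -(Real.pi * I / 2) by
        linear_combination (Real.pi * b * (θ0 - θs)) * I_mul_I,
      Complex.exp_add, Complex.exp_add, Complex.exp_neg (Real.pi * I / 2), hexp_half_pi,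
      Complex.inv_I]
    ring

/-- The connection relation holds at every point of the universal cover. -/
theorem blockD_eq_mulVec {b θ0 : ℂ} (hb : ∀ m : ℤ, b ^ 2 ≠ (m : ℂ))
    (hθ0 : ∀ m : ℤ, 2 * I * b * θ0 ≠ (m : ℂ)) (θs : ℂ) (n : ℤ) (s : ℂ) :
    blockD b θs θ0 n s = (!![Kpp b n θs θ0, Kpp b n θs (-θ0);
      Kmp b n θs θ0, Kmp b n θs (-θ0)] : Matrix (Fin 2) (Fin 2) ℂ).mulVec
        (blockB b θs θ0 s) := by
  have hpos : ∀ m : ℤ, 2 * (I * b * θ0) ≠ m := fun m h => hθ0 m (by rw [← h]; ring)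
  have hneg : ∀ m : ℤ, 2 * (-(I * b * θ0)) ≠ m := fun m h =>
    hθ0 (-m) (by push_cast; rw [← h]; ring)
  ext i
  fin_cases i
  · simp only [blockD, blockB, Matrix.mulVec, dotProduct, Fin.sum_univ_two, Fin.zero_eta,
      Matrix.cons_val_zero, Matrix.cons_val_one, Matrix.of_apply]
    rw [whittakerW_eq, whittakerM_sub_full_turn, neg_neg, whittakerM_sub_full_turn, Kpp_eq hb,
      Kpp_eq hb]
    set p : ℂ := (((n - 1) / 2 : ℤ) : ℂ)
    rw [show 2 * I * Real.pi * p * (-(1 / 2) + I * b * (θ0 - θs))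
        = 2 * Real.pi * b * θs * p + -(2 * I * Real.pi * p * (1 / 2 + -(I * b * θ0))) by
        linear_combination (-(2 * Real.pi * p * b * θs)) * I_mul_I,
      show 2 * I * Real.pi * p * (-(1 / 2) + I * b * (-θ0 - θs))
        = 2 * Real.pi * b * θs * p + -(2 * I * Real.pi * p * (1 / 2 + I * b * θ0)) by
        linear_combination (-(2 * Real.pi * p * b * θs)) * I_mul_I,
      Complex.exp_add, Complex.exp_add,
      show -(2 * -(I * b * θ0)) = 2 * I * b * θ0 by ring,
      show 2 * -(I * b * θ0) = 2 * I * b * -θ0 by ring,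
      show 1 / 2 - -(I * b * θ0) - -(I * b * θs) = 1 / 2 + I * b * (θ0 + θs) by ring,
      show 1 / 2 + -(I * b * θ0) - -(I * b * θs) = 1 / 2 + I * b * (-θ0 + θs) by ring]
    ring
  · simp only [blockD, blockB, Matrix.mulVec, dotProduct, Fin.sum_univ_two, Fin.mk_one,
      Matrix.cons_val_zero, Matrix.cons_val_one, Matrix.of_apply]
    rw [whittakerW_eq, whittakerM_sub_half_turn hneg, neg_neg, whittakerM_sub_half_turn hpos,
      Kmp, Kmp]
    set q : ℂ := ((n / 2 : ℤ) : ℂ) - 1 / 2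
    rw [show -(2 * I * Real.pi * q * (1 / 2 - I * b * (θ0 + θs)))
        = -(2 * Real.pi * b * θs * q) + -(2 * I * Real.pi * q * (1 / 2 + -(I * b * θ0))) by
        linear_combination (2 * Real.pi * q * b * θs) * I_mul_I,
      show -(2 * I * Real.pi * q * (1 / 2 - I * b * (-θ0 + θs)))
        = -(2 * Real.pi * b * θs * q) + -(2 * I * Real.pi * q * (1 / 2 + I * b * θ0)) by
        linear_combination (2 * Real.pi * q * b * θs) * I_mul_I,
      Complex.exp_add, Complex.exp_add,
      show -(2 * -(I * b * θ0)) = 2 * I * b * θ0 by ring,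
      show 2 * -(I * b * θ0) = 2 * I * b * -θ0 by ring,
      show 1 / 2 - -(I * b * θ0) - I * b * θs = 1 / 2 + I * b * (θ0 - θs) by ring,
      show 1 / 2 + -(I * b * θ0) - I * b * θs = 1 / 2 + I * b * (-θ0 - θs) by ring]
    ring

/-! ### Linear independence of the blocks -/

theorem differentiable_whittakerM (k μ : ℂ) : Differentiable ℂ (whittakerM k μ) := by
  have hF : Differentiable ℂ fun s => hyp1F1 (1 / 2 - k + μ) (1 + 2 * μ) (exp s) :=
    (differentiable_hyp1F1 _ _).comp Complex.differentiable_exp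
  unfold whittakerM
  exact Differentiable.mul (by fun_prop) hF

/-- `M_{k, μ}` does not vanish identically, since `₁F₁` tends to `1` as `t → 0`. -/
theorem exists_whittakerM_ne_zero (k μ : ℂ) : ∃ s, whittakerM k μ s ≠ 0 := by
  have hcont : Filter.Tendsto (fun x : ℝ => hyp1F1 (1 / 2 - k + μ) (1 + 2 * μ) (exp x))
      Filter.atBot (nhds 1) := by
    have h1 := (differentiable_hyp1F1 (1 / 2 - k + μ) (1 + 2 * μ)).continuous.tendsto 0
    rw [hyp1F1_zero] at h1
    refine h1.comp ?_
    have h2 := (Complex.continuous_ofReal.tendsto 0).comp Real.tendsto_exp_atBot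
    simpa [Function.comp_def] using h2
  obtain ⟨x, hx⟩ := (hcont.eventually_ne one_ne_zero).exists
  exact ⟨x, mul_ne_zero (mul_ne_zero (Complex.exp_ne_zero _) (Complex.exp_ne_zero _)) hx⟩

theorem whittakerM_linearIndependent {μ : ℂ} (hμ : ∀ m : ℤ, 2 * μ ≠ m) (k : ℂ) {u : Set ℂ}
    (hu : IsOpen u) (hne : u.Nonempty) {x y : ℂ}
    (h : ∀ s ∈ u, x * whittakerM k μ s + y * whittakerM k (-μ) s = 0) : x = 0 ∧ y = 0 := by
  obtain ⟨s₀, hs₀⟩ := hne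
  have hdiff : Differentiable ℂ fun s => x * whittakerM k μ s + y * whittakerM k (-μ) s :=
    ((differentiable_whittakerM k μ).const_mul x).add
      ((differentiable_whittakerM k (-μ)).const_mul y)
  have hall : ∀ s, x * whittakerM k μ s + y * whittakerM k (-μ) s = 0 := fun s => by
    have han := Complex.analyticOnNhd_univ_iff_differentiable.mpr hdiff
    have := han.eqOn_zero_of_preconnected_of_eventuallyEq_zero isPreconnected_univ
      (Set.mem_univ s₀) (Filter.mem_of_superset (hu.mem_nhds hs₀) h) (Set.mem_univ s)
    simpa using this
  -- The monodromy factors `exp (-2πi (1/2 ± μ))` of the two functions around `t = 0` differ.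
  have hfactor : exp (-(2 * I * Real.pi * (1 : ℤ) * (1 / 2 + μ)))
      ≠ exp (-(2 * I * Real.pi * (1 : ℤ) * (1 / 2 + -μ))) := fun heq => by
    obtain ⟨m, hm⟩ := Complex.exp_eq_exp_iff_exists_int.mp heq
    refine hμ (-m) (mul_left_cancel₀ Complex.two_pi_I_ne_zero ?_)
    push_cast at hm ⊢
    linear_combination -hm
  have hy : y = 0 := by
    obtain ⟨s, hs⟩ := exists_whittakerM_ne_zero k (-μ)
    have h1 := hall s
    have h2 := hall (s - 2 * I * Real.pi * (1 : ℤ))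
    rw [whittakerM_sub_full_turn, whittakerM_sub_full_turn] at h2
    have h3 : y * ((exp (-(2 * I * Real.pi * (1 : ℤ) * (1 / 2 + μ)))
        - exp (-(2 * I * Real.pi * (1 : ℤ) * (1 / 2 + -μ)))) * whittakerM k (-μ) s) = 0 := by
      linear_combination exp (-(2 * I * Real.pi * (1 : ℤ) * (1 / 2 + μ))) * h1 - h2
    exact (mul_eq_zero.mp h3).resolve_right (mul_ne_zero (sub_ne_zero.mpr hfactor) hs)
  refine ⟨?_, hy⟩
  obtain ⟨s, hs⟩ := exists_whittakerM_ne_zero k μ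
  have h1 := hall s
  rw [hy, zero_mul, add_zero] at h1
  exact (mul_eq_zero.mp h1).resolve_right hs

theorem blockB_linearIndependent {b θ0 : ℂ} (hθ0 : ∀ m : ℤ, 2 * I * b * θ0 ≠ (m : ℂ)) (θs : ℂ)
    {u : Set ℂ} (hu : IsOpen u) (hne : u.Nonempty) {x y : ℂ}
    (h : ∀ s ∈ u, x * blockB b θs θ0 s 0 + y * blockB b θs θ0 s 1 = 0) : x = 0 ∧ y = 0 := by
  have hneg : ∀ m : ℤ, 2 * (-(I * b * θ0)) ≠ m := fun m h =>
    hθ0 (-m) (by push_cast; rw [← h]; ring)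
  refine whittakerM_linearIndependent hneg (-(I * b * θs)) hu hne fun s hs => ?_
  have hs' := h s hs
  simp only [blockB, Matrix.cons_val_zero, Matrix.cons_val_one] at hs'
  rw [neg_neg]
  refine (mul_eq_zero.mp (?_ : exp (b ^ 2 / 2 * s) * _ = 0)).resolve_left (Complex.exp_ne_zero _)
  linear_combination hs'

theorem isOpen_stokesSector (n : ℤ) : IsOpen (stokesSector n) :=
  (isOpen_lt continuous_const Complex.continuous_im).inter
    (isOpen_lt Complex.continuous_im continuous_const)

theorem stokesSector_nonempty (n : ℤ) : (stokesSector n).Nonempty := by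
  refine ⟨⟨0, Real.pi * ((n : ℝ) - 1)⟩, ?_, ?_⟩ <;> simp [Real.pi_pos]

end ConfluentBPZ

theorem mainTheorem8 (b θs θ0 : ℂ)
    (hb : ∀ m : ℤ, b ^ 2 ≠ (m : ℂ))
    (hθ0 : ∀ m : ℤ, 2 * Complex.I * b * θ0 ≠ (m : ℂ))
    (n : ℤ) (hn : 1 ≤ n) (C : Matrix (Fin 2) (Fin 2) ℂ) :
    ConfluentBPZ.IsConnectionMatrix b θs θ0 n C ↔
      C = !![ConfluentBPZ.Kpp b n θs θ0, ConfluentBPZ.Kpp b n θs (-θ0);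
             ConfluentBPZ.Kmp b n θs θ0, ConfluentBPZ.Kmp b n θs (-θ0)] := by
  constructor
  · intro hC
    set C₀ : Matrix (Fin 2) (Fin 2) ℂ :=
      !![ConfluentBPZ.Kpp b n θs θ0, ConfluentBPZ.Kpp b n θs (-θ0);
         ConfluentBPZ.Kmp b n θs θ0, ConfluentBPZ.Kmp b n θs (-θ0)] with hC₀
    have hrow : ∀ i, C i 0 - C₀ i 0 = 0 ∧ C i 1 - C₀ i 1 = 0 := fun i => by
      refine ConfluentBPZ.blockB_linearIndependent hθ0 θs
        (ConfluentBPZ.isOpen_stokesSector n) (ConfluentBPZ.stokesSector_nonempty n) fun s hs => ?_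
      have h := congrFun ((hC s hs).symm.trans (ConfluentBPZ.blockD_eq_mulVec hb hθ0 θs n s)) i
      rw [← hC₀] at h
      simp only [Matrix.mulVec, dotProduct, Fin.sum_univ_two] at h
      linear_combination h
    ext i j
    fin_cases j
    · exact sub_eq_zero.mp (hrow i).1
    · exact sub_eq_zero.mp (hrow i).2
  · rintro rfl s -
    exact ConfluentBPZ.blockD_eq_mulVec hb hθ0 θs n s
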